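/- Fix the standard basis $\{|0\rangle,|1\rangle\}$ of $\mathbb{C}^2$. A state is incoherent if it is diagonal in this basis. An operator $K$ is incoherent if it maps each basis vector to a (possibly zero) multiple of a basis vector, and strictly incoherent if both $K$ and $K^\dagger$ are incoherent. An incoherent operation (IO), respectively a strictly incoherent operation (SIO), is a map $\Lambda(X)=\sum_j K_jXK_j^\dagger$ given by finitely many incoherent, respectively strictly incoherent, operators $K_j$ with $\sum_j K_j^\dagger K_j=\mathbb{1}$. A maximally incoherent operation (MIO) is a completely positive trace-preserving linear map that sends every incoherent state to an incoherent state. Let $\rho$ and $\sigma$ be single-qubit states with Bloch vectors $r=(r_x,r_y,r_z)$ and $s=(s_x,s_y,s_z)$, that is, $\rho=\tfrac12(\mathbb{1}+r_x\sigma_x+r_y\sigma_y+r_z\sigma_z)$, and similarly for $\sigma$. If $r_x^2+r_y^2\neq 0$, then for each of the three classes SIO, IO and MIO, there is an operation $\Lambda$ of that class with $\Lambda(\rho)=\sigma$ if and only if $$s_x^2+s_y^2\le r_x^2+r_y^2\qquad\text{and}\qquad s_z^2\le 1-\frac{1-r_z^2}{r_x^2+r_y^2}\,(s_x^2+s_y^2).$$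 If $r_x^2+r_y^2=0$ (so that $\rho$ is incoherent), then for each of the three classes such an operation exists if and only if $s_x=s_y=0$. -/

import Mathlib

open scoped ComplexOrder

namespace Coherence

variable {n : Type*} [Fintype n] [DecidableEq n]

/-- Density matrices: positive semidefinite complex matrices of trace one. -/
def IsDensityMatrix (ρ : Matrix n n ℂ) : Prop :=
  ρ.PosSemidef ∧ ρ.trace = 1

/-- Incoherent states: density matrices that are diagonal in the standard basis. -/
def IsIncoherentState (ρ : Matrix n n ℂ) : Prop :=
  IsDensityMatrix ρ ∧ ρ.IsDiag

/-- An operator is incoherent if it maps each standard basis vector `|m⟩` to a scalar multiple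
(possibly zero) of some standard basis vector `|l⟩`. -/
def IsIncoherentOperator (K : Matrix n n ℂ) : Prop :=
  ∀ m : n, ∃ (l : n) (c : ℂ),
    K.mulVec (Pi.single m (1 : ℂ)) = c • (Pi.single l (1 : ℂ) : n → ℂ)

/-- An operator is strictly incoherent if both it and its adjoint are incoherent. -/
def IsStrictlyIncoherentOperator (K : Matrix n n ℂ) : Prop :=
  IsIncoherentOperator K ∧ IsIncoherentOperator K.conjTranspose

/-- The finite family `K` is a Kraus decomposition of `Λ`: the completeness relation holds and
`Λ X = ∑ j, K j * X * (K j)†` for all `X`. -/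
def IsKrausDecomposition {k : ℕ} (K : Fin k → Matrix n n ℂ)
    (Λ : Matrix n n ℂ →ₗ[ℂ] Matrix n n ℂ) : Prop :=
  ∑ j, (K j).conjTranspose * K j = 1 ∧
    ∀ X : Matrix n n ℂ, Λ X = ∑ j, K j * X * (K j).conjTranspose

/-- The ampliation `id ⊗ Λ` of `Λ` by an `m`-dimensional ancilla: `Λ` is applied to each block
of an `m × m` block matrix. -/
def ampliation (Λ : Matrix n n ℂ →ₗ[ℂ] Matrix n n ℂ) (m : ℕ)
    (M : Matrix (Fin m × n) (Fin m × n) ℂ) : Matrix (Fin m × n) (Fin m × n) ℂ :=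
  Matrix.of fun a b => Λ (Matrix.of fun i j => M (a.1, i) (b.1, j)) a.2 b.2

/-- Quantum operations: completely positive trace-preserving linear maps. -/
def IsQuantumOperation (Λ : Matrix n n ℂ →ₗ[ℂ] Matrix n n ℂ) : Prop :=
  (∀ (m : ℕ) (M : Matrix (Fin m × n) (Fin m × n) ℂ),
    M.PosSemidef → (ampliation Λ m M).PosSemidef) ∧
  ∀ X : Matrix n n ℂ, (Λ X).trace = X.trace

/-- Strictly incoherent operations: those with a strictly incoherent Kraus decomposition. -/
def IsStrictlyIncoherentOperation (Λ : Matrix n n ℂ →ₗ[ℂ] Matrix n n ℂ) : Prop :=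
  ∃ (k : ℕ) (K : Fin k → Matrix n n ℂ),
    IsKrausDecomposition K Λ ∧ ∀ j, IsStrictlyIncoherentOperator (K j)

/-- Incoherent operations: those with an incoherent Kraus decomposition. -/
def IsIncoherentOperation (Λ : Matrix n n ℂ →ₗ[ℂ] Matrix n n ℂ) : Prop :=
  ∃ (k : ℕ) (K : Fin k → Matrix n n ℂ),
    IsKrausDecomposition K Λ ∧ ∀ j, IsIncoherentOperator (K j)

/-- Maximally incoherent operations: quantum operations that map every incoherent state to an
incoherent state. -/
def IsMaximallyIncoherentOperation (Λ : Matrix n n ℂ →ₗ[ℂ] Matrix n n ℂ) : Prop :=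
  IsQuantumOperation Λ ∧ ∀ δ : Matrix n n ℂ, IsIncoherentState δ → IsIncoherentState (Λ δ)

/-- `ρ` can be converted into `σ` by an operation of the class `C`. -/
def Convertible (C : (Matrix n n ℂ →ₗ[ℂ] Matrix n n ℂ) → Prop) (ρ σ : Matrix n n ℂ) : Prop :=
  ∃ Λ : Matrix n n ℂ →ₗ[ℂ] Matrix n n ℂ, C Λ ∧ Λ ρ = σ

/-- The Pauli matrices `σ_x, σ_y, σ_z`. -/
def pauli : Fin 3 → Matrix (Fin 2) (Fin 2) ℂ :=
  ![!![0, 1; 1, 0], !![0, -Complex.I; Complex.I, 0], !![1, 0; 0, -1]]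

/-- `r` is the Bloch vector of `ρ`: `ρ = (1 + r_x σ_x + r_y σ_y + r_z σ_z) / 2`. -/
def HasBlochVector (ρ : Matrix (Fin 2) (Fin 2) ℂ) (r : Fin 3 → ℝ) : Prop :=
  ρ = (1 / 2 : ℂ) • (1 + ∑ i, (r i : ℂ) • pauli i)

end Coherence

/-! Since SIO ⊆ IO ⊆ MIO, necessity is needed only for MIO and sufficiency only for SIO
(`convertible_iff_of_necessary_of_sufficient`). Necessity: split `ρ` into its diagonal and
off-diagonal parts, with images `D` and `F` under `Λ`. As `D` is diagonal, the coherence of `σ` sits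
in `F`, and rescaling the off-diagonal part by `k` turns the image into `D + k F`. Positivity for
suitable pure inputs gives both inequalities (`necessary_of_coherent`). Sufficiency: a diagonal and
an antidiagonal Kraus operator, with entries the cosines and sines of two angles up to phases, reach
every allowed `σ` (`exists_angles`, `sufficient_of_coherent`). For incoherent targets it is enough
to discard the input and prepare `σ`. -/

namespace Coherence

/-! ### Inclusions between the three classes of operations -/

section Inclusions

variable {n : Type*} [Fintype n]

/-- Quantum operations map density matrices to density matrices. -/
theorem IsQuantumOperation.isDensityMatrix {Λ : Matrix n n ℂ →ₗ[ℂ] Matrix n n ℂ}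
    (h : IsQuantumOperation Λ) {ρ : Matrix n n ℂ} (hρ : IsDensityMatrix ρ) :
    IsDensityMatrix (Λ ρ) :=
  -- Positivity is complete positivity with a one-dimensional ancilla, up to reindexing.
  ⟨(h.1 1 _ (hρ.1.submatrix Prod.snd)).submatrix (fun i => ((0 : Fin 1), i)),
    (h.2 ρ).trans hρ.2⟩

variable [DecidableEq n]

theorem IsStrictlyIncoherentOperation.isIncoherentOperation
    {Λ : Matrix n n ℂ →ₗ[ℂ] Matrix n n ℂ} (h : IsStrictlyIncoherentOperation Λ) :
    IsIncoherentOperation Λ := by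
  obtain ⟨k, K, hK, hs⟩ := h
  exact ⟨k, K, hK, fun j => (hs j).1⟩

/-- Every column of an incoherent operator has at most one nonzero entry. -/
theorem IsIncoherentOperator.mul_eq_zero {K : Matrix n n ℂ} (hK : IsIncoherentOperator K)
    (m : n) {a b : n} (hab : a ≠ b) : K a m * star (K b m) = 0 := by
  obtain ⟨l, c, h⟩ := hK m
  have hcol : ∀ i, K i m = (c • (Pi.single l (1 : ℂ) : n → ℂ)) i := fun i => by
    rw [← h, Matrix.mulVec_single_one, Matrix.col_apply]
  rw [hcol a, hcol b]
  by_cases ha : a = l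
  · have hb : b ≠ l := fun hb => hab (ha.trans hb.symm)
    simp [hb]
  · simp [ha]

/-- Conjugation by an incoherent operator preserves diagonal matrices. -/
theorem IsIncoherentOperator.isDiag_mul_mul_conjTranspose {K : Matrix n n ℂ}
    (hK : IsIncoherentOperator K) {δ : Matrix n n ℂ} (hδ : δ.IsDiag) :
    (K * δ * K.conjTranspose).IsDiag := by
  intro a b hab
  rw [← hδ.diagonal_diag, Matrix.mul_apply]
  refine Finset.sum_eq_zero fun m _ => ?_
  rw [Matrix.mul_diagonal, Matrix.conjTranspose_apply]
  linear_combination Matrix.diag δ m * hK.mul_eq_zero m hab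

theorem IsKrausDecomposition.isQuantumOperation {k : ℕ} {K : Fin k → Matrix n n ℂ}
    {Λ : Matrix n n ℂ →ₗ[ℂ] Matrix n n ℂ} (h : IsKrausDecomposition K Λ) :
    IsQuantumOperation Λ := by
  obtain ⟨hc, hΛ⟩ := h
  refine ⟨fun m M hM => ?_, fun X => ?_⟩
  -- The ampliation has Kraus operators `1 ⊗ K j`.
  · have key : ampliation Λ m M = ∑ j,
        Matrix.kroneckerMap (· * ·) (1 : Matrix (Fin m) (Fin m) ℂ) (K j) * M *
          (Matrix.kroneckerMap (· * ·) (1 : Matrix (Fin m) (Fin m) ℂ) (K j)).conjTranspose := by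
      ext ⟨a, i⟩ ⟨b, j⟩
      simp only [ampliation, Matrix.of_apply, hΛ, Matrix.sum_apply, Matrix.mul_apply,
        Matrix.conjTranspose_apply, Matrix.kroneckerMap_apply, Fintype.sum_prod_type,
        Matrix.one_apply, ite_mul, one_mul, zero_mul, apply_ite star, star_zero, mul_ite, mul_zero]
      simp
    rw [key]
    exact Matrix.posSemidef_sum _ fun j _ => hM.mul_mul_conjTranspose_same _
  · rw [hΛ, Matrix.trace_sum]
    simp_rw [Matrix.trace_mul_cycle (K _) X]
    rw [← Matrix.trace_sum, ← Finset.sum_mul, hc, one_mul]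

theorem IsIncoherentOperation.isMaximallyIncoherentOperation
    {Λ : Matrix n n ℂ →ₗ[ℂ] Matrix n n ℂ} (h : IsIncoherentOperation Λ) :
    IsMaximallyIncoherentOperation Λ := by
  obtain ⟨k, K, hK, hi⟩ := h
  refine ⟨hK.isQuantumOperation, fun δ hδ =>
    ⟨hK.isQuantumOperation.isDensityMatrix hδ.1, fun a b hab => ?_⟩⟩
  change Λ δ a b = 0
  rw [hK.2, Matrix.sum_apply]
  exact Finset.sum_eq_zero fun j _ => (hi j).isDiag_mul_mul_conjTranspose hδ.2 hab

/-- A condition that is necessary under maximally incoherent operations and sufficient under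
strictly incoherent ones characterizes convertibility under all three classes. -/
theorem convertible_iff_of_necessary_of_sufficient {ρ σ : Matrix n n ℂ} {P : Prop}
    (hn : Convertible IsMaximallyIncoherentOperation ρ σ → P)
    (hs : P → Convertible IsStrictlyIncoherentOperation ρ σ) :
    (Convertible IsStrictlyIncoherentOperation ρ σ ↔ P) ∧
    (Convertible IsIncoherentOperation ρ σ ↔ P) ∧
    (Convertible IsMaximallyIncoherentOperation ρ σ ↔ P) := by
  have h1 : Convertible IsStrictlyIncoherentOperation ρ σ →
      Convertible IsIncoherentOperation ρ σ :=
    fun ⟨Λ, hΛ, h⟩ => ⟨Λ, hΛ.isIncoherentOperation, h⟩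
  have h2 : Convertible IsIncoherentOperation ρ σ →
      Convertible IsMaximallyIncoherentOperation ρ σ :=
    fun ⟨Λ, hΛ, h⟩ => ⟨Λ, hΛ.isMaximallyIncoherentOperation, h⟩
  exact ⟨⟨fun h => hn (h2 (h1 h)), hs⟩, ⟨fun h => hn (h2 h), fun h => h1 (hs h)⟩,
    ⟨hn, fun h => h2 (h1 (hs h))⟩⟩

/-- The linear map with given Kraus operators. -/
def krausMap {k : ℕ} (K : Fin k → Matrix n n ℂ) : Matrix n n ℂ →ₗ[ℂ] Matrix n n ℂ where
  toFun X := ∑ j, K j * X * (K j).conjTranspose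
  map_add' X Y := by simp [mul_add, add_mul, Finset.sum_add_distrib]
  map_smul' c X := by simp [Finset.smul_sum]

theorem convertible_of_kraus {k : ℕ} (K : Fin k → Matrix n n ℂ)
    (hK : ∀ j, IsStrictlyIncoherentOperator (K j))
    (hc : ∑ j, (K j).conjTranspose * K j = 1) {ρ σ : Matrix n n ℂ}
    (h : ∑ j, K j * ρ * (K j).conjTranspose = σ) :
    Convertible IsStrictlyIncoherentOperation ρ σ :=
  ⟨krausMap K, ⟨k, K, ⟨hc, fun _ => rfl⟩, hK⟩, h⟩

end Inclusions

/-! ### Qubit states and Bloch vectors -/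

section Qubit

theorem hasBlochVector_iff {ρ : Matrix (Fin 2) (Fin 2) ℂ} {r : Fin 3 → ℝ} :
    HasBlochVector ρ r ↔ ρ = !![(1 + r 2 : ℂ) / 2, (r 0 - r 1 * Complex.I) / 2;
      (r 0 + r 1 * Complex.I) / 2, (1 - r 2) / 2] := by
  unfold HasBlochVector
  have : (1 / 2 : ℂ) • (1 + ∑ i, (r i : ℂ) • pauli i) =
      !![(1 + r 2 : ℂ) / 2, (r 0 - r 1 * Complex.I) / 2;
        (r 0 + r 1 * Complex.I) / 2, (1 - r 2) / 2] := by
    ext i j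
    fin_cases i <;> fin_cases j <;> simp [Fin.sum_univ_three, pauli] <;> ring
  rw [this]

/-- The off-diagonal entry of a qubit density matrix is bounded by the diagonal. -/
theorem IsDensityMatrix.normSq_le {ω : Matrix (Fin 2) (Fin 2) ℂ} (h : IsDensityMatrix ω) :
    Complex.normSq (ω 0 1) ≤ (ω 0 0).re * (1 - (ω 0 0).re) := by
  have hd := (Complex.le_def.1 h.1.det_nonneg).1
  have h10 : ω 1 0 = star (ω 0 1) := (h.1.isHermitian.apply 1 0).symm
  have h00 : star (ω 0 0) = ω 0 0 := h.1.isHermitian.apply 0 0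
  have him : (ω 0 0).im = 0 := Complex.conj_eq_iff_im.1 h00
  have h11 : ω 1 1 = 1 - ω 0 0 := by
    have := h.2
    rw [Matrix.trace_fin_two] at this
    linear_combination this
  rw [Matrix.det_fin_two, h10, h11] at hd
  simp [him] at hd
  rw [Complex.normSq_apply]
  linarith

theorem HasBlochVector.sq_le {ρ : Matrix (Fin 2) (Fin 2) ℂ} {r : Fin 3 → ℝ}
    (hr : HasBlochVector ρ r) (h : IsDensityMatrix ρ) : r 0 ^ 2 + r 1 ^ 2 ≤ 1 - r 2 ^ 2 := by
  have := h.normSq_le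
  rw [hasBlochVector_iff.1 hr] at this
  simp [Complex.normSq_apply] at this
  linarith

/-- A unit Bloch vector describes a (pure) state. -/
theorem isDensityMatrix_of_unit {x y z : ℝ} (h : x ^ 2 + y ^ 2 + z ^ 2 = 1) :
    IsDensityMatrix (!![(1 + z) / 2, (x - y * Complex.I) / 2;
      (x + y * Complex.I) / 2, (1 - z) / 2] : Matrix (Fin 2) (Fin 2) ℂ) := by
  refine ⟨?_, ?_⟩
  · have hC : (x : ℂ) ^ 2 + y ^ 2 + z ^ 2 = 1 := by exact_mod_cast h
    have hI := Complex.I_sq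
    -- For a unit Bloch vector the matrix `P` is a Hermitian projection, so `P = P† P`.
    convert Matrix.posSemidef_conjTranspose_mul_self (!![(1 + z) / 2, (x - y * Complex.I) / 2;
      (x + y * Complex.I) / 2, (1 - z) / 2] : Matrix (Fin 2) (Fin 2) ℂ) using 1
    ext i j
    fin_cases i <;> fin_cases j <;>
      simp [Matrix.mul_apply, Fin.sum_univ_two, Complex.conj_ofNat]
    · linear_combination (-1 / 4 : ℂ) * hC + y ^ 2 / 4 * hI
    · ring
    · ring
    · linear_combination (-1 / 4 : ℂ) * hC + y ^ 2 / 4 * hI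
  · rw [Matrix.trace_fin_two]
    simp
    ring

theorem isIncoherentState_of_sq_le {z : ℝ} (h : z ^ 2 ≤ 1) :
    IsIncoherentState (Matrix.diagonal ![((1 + z) / 2 : ℂ), (1 - z) / 2]) := by
  obtain ⟨h1, h2⟩ := abs_le.1 ((sq_le_one_iff_abs_le_one z).1 h)
  refine ⟨⟨Matrix.PosSemidef.diagonal fun i => ?_, ?_⟩, Matrix.isDiag_diagonal _⟩
  · fin_cases i
    · have : (0 : ℝ) ≤ (1 + z) / 2 := by linarith
      simpa using (by exact_mod_cast this : (0 : ℂ) ≤ (1 + z) / 2)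
    · have : (0 : ℝ) ≤ (1 - z) / 2 := by linarith
      simpa using (by exact_mod_cast this : (0 : ℂ) ≤ (1 - z) / 2)
  · rw [Matrix.trace_fin_two]
    simp
    ring

/-! ### Necessity under maximally incoherent operations -/

/-- A maximally incoherent operation `Λ` applied to the pure state with Bloch vector
`(k x, k y, z)`: the off-diagonal part of the image is determined by `(k x, k y)` alone. -/
theorem IsMaximallyIncoherentOperation.normSq_le
    {Λ : Matrix (Fin 2) (Fin 2) ℂ →ₗ[ℂ] Matrix (Fin 2) (Fin 2) ℂ}
    (h : IsMaximallyIncoherentOperation Λ) {x y z k : ℝ}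
    (hk : k ^ 2 * (x ^ 2 + y ^ 2) + z ^ 2 = 1) {D F : Matrix (Fin 2) (Fin 2) ℂ}
    (hD : D = Λ (Matrix.diagonal ![((1 + z) / 2 : ℂ), (1 - z) / 2]))
    (hF : F = Λ !![0, (x - y * Complex.I) / 2; (x + y * Complex.I) / 2, 0]) :
    k ^ 2 * Complex.normSq (F 0 1) ≤
      ((D 0 0).re + k * (F 0 0).re) * (1 - ((D 0 0).re + k * (F 0 0).re)) := by
  have hz : z ^ 2 ≤ 1 := by
    nlinarith [mul_nonneg (sq_nonneg k) (add_nonneg (sq_nonneg x) (sq_nonneg y))]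
  have hdiag : D 0 1 = 0 := by
    rw [hD]
    exact (h.2 _ (isIncoherentState_of_sq_le hz)).2 (by decide)
  have hω : IsDensityMatrix (D + (k : ℂ) • F) := by
    have := h.1.isDensityMatrix (isDensityMatrix_of_unit (x := k * x) (y := k * y) (z := z)
      (by linear_combination hk))
    convert this using 1
    rw [hD, hF, ← map_smul, ← map_add]
    congr 1
    ext i j
    fin_cases i <;> fin_cases j <;> simp <;> ring
  have := hω.normSq_le
  simp only [Matrix.add_apply, Matrix.smul_apply, hdiag, zero_add, smul_eq_mul, map_mul,
    Complex.normSq_ofReal, Complex.add_re, Complex.re_ofReal_mul] at this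
  linarith

theorem necessary_of_coherent {ρ σ : Matrix (Fin 2) (Fin 2) ℂ} (hρ : IsDensityMatrix ρ)
    {r s : Fin 3 → ℝ} (hr : HasBlochVector ρ r) (hs : HasBlochVector σ s)
    (ht : r 0 ^ 2 + r 1 ^ 2 ≠ 0)
    (hc : Convertible IsMaximallyIncoherentOperation ρ σ) :
    s 0 ^ 2 + s 1 ^ 2 ≤ r 0 ^ 2 + r 1 ^ 2 ∧
      s 2 ^ 2 ≤ 1 - (1 - r 2 ^ 2) / (r 0 ^ 2 + r 1 ^ 2) * (s 0 ^ 2 + s 1 ^ 2) := by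
  obtain ⟨Λ, hΛ, hΛρ⟩ := hc
  have hle := hr.sq_le hρ
  set t := r 0 ^ 2 + r 1 ^ 2 with ht_def
  have htpos : 0 < t := lt_of_le_of_ne (by positivity) (Ne.symm ht)
  obtain ⟨F, hF⟩ : ∃ F, F = Λ !![0, (r 0 - r 1 * Complex.I) / 2;
    (r 0 + r 1 * Complex.I) / 2, 0] := ⟨_, rfl⟩
  obtain ⟨D, hD⟩ : ∃ D, D = Λ (Matrix.diagonal ![((1 + r 2) / 2 : ℂ), (1 - r 2) / 2]) :=
    ⟨_, rfl⟩
  have hσ : σ = D + F := by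
    rw [← hΛρ, hasBlochVector_iff.1 hr, hD, hF, ← map_add]
    congr 1
    ext i j
    fin_cases i <;> fin_cases j <;> simp
  have hD01 : D 0 1 = 0 := by
    rw [hD]
    exact (hΛ.2 _ (isIncoherentState_of_sq_le (by linarith))).2 (by decide)
  have hF01 : Complex.normSq (F 0 1) = (s 0 ^ 2 + s 1 ^ 2) / 4 := by
    have : F 0 1 = σ 0 1 := by rw [hσ, Matrix.add_apply, hD01, zero_add]
    rw [this, hasBlochVector_iff.1 hs]
    simp [Complex.normSq_apply]
    ring
  have h00 : (D 0 0).re + (F 0 0).re = (1 + s 2) / 2 := by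
    rw [← Complex.add_re, ← Matrix.add_apply, ← hσ, hasBlochVector_iff.1 hs]
    simp
  constructor
  -- Test on the equatorial pure state in the direction of `(r 0, r 1)`: an off-diagonal entry of a
  -- state has modulus at most 1/2.
  · have hk : (1 / √t) ^ 2 * t + 0 ^ 2 = 1 := by
      rw [div_pow, Real.sq_sqrt htpos.le]
      field_simp
      ring
    have := hΛ.normSq_le hk rfl hF
    set a : ℝ := _ + 1 / √t * (F 0 0).re
    have h4 : (1 / √t) ^ 2 * ((s 0 ^ 2 + s 1 ^ 2) / 4) ≤ 1 / 4 := by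
      rw [← hF01]
      nlinarith [sq_nonneg (a - 1 / 2)]
    rw [div_pow, Real.sq_sqrt htpos.le, one_pow, one_div_mul_eq_div, div_le_iff₀ htpos] at h4
    linarith
  -- The pure states at height `r 2` with transverse parts `±k (r 0, r 1)`; `ρ` lies on the segment
  -- between them, hence `1 ≤ k`.
  · set k := √((1 - r 2 ^ 2) / t) with hk_def
    have hk2 : k ^ 2 = (1 - r 2 ^ 2) / t := Real.sq_sqrt (div_nonneg (by linarith) htpos.le)
    have hk1 : 1 ≤ k := by
      rw [hk_def, Real.one_le_sqrt, le_div_iff₀ htpos]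
      linarith
    have hk : k ^ 2 * t + r 2 ^ 2 = 1 := by
      rw [hk2]
      field_simp
      ring
    have hp := hΛ.normSq_le hk hD hF
    have hm := hΛ.normSq_le (k := -k) (by rw [neg_sq]; exact hk) hD hF
    rw [hF01] at hp hm
    rw [← hk2]
    have hs2 : s 2 = 2 * ((D 0 0).re + (F 0 0).re) - 1 := by linarith
    rw [hs2]
    generalize (D 0 0).re = d at *
    generalize (F 0 0).re = f at *
    -- Concavity of `p (1 - p)`: its lower bound at `d ± k f` persists at the intermediate point `d
    -- + f = (1 + s 2) / 2`.
    have hmul : f ^ 2 ≤ k ^ 2 * f ^ 2 := le_mul_of_one_le_left (sq_nonneg f) (by nlinarith)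
    have hpm : k * ((1 - 2 * d) * f) + (d * (1 - d) - k ^ 2 * f ^ 2) ≥
        k ^ 2 * ((s 0 ^ 2 + s 1 ^ 2) / 4) := by linarith
    have hmm : -(k * ((1 - 2 * d) * f)) + (d * (1 - d) - k ^ 2 * f ^ 2) ≥
        k ^ 2 * ((s 0 ^ 2 + s 1 ^ 2) / 4) := by linarith
    have hlin : -(d * (1 - d) - k ^ 2 * f ^ 2 - k ^ 2 * ((s 0 ^ 2 + s 1 ^ 2) / 4)) ≤
        (1 - 2 * d) * f := by
      by_contra! hcon
      nlinarith
    nlinarith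

theorem necessary_of_incoherent {ρ σ : Matrix (Fin 2) (Fin 2) ℂ} (hρ : IsDensityMatrix ρ)
    {r s : Fin 3 → ℝ} (hr : HasBlochVector ρ r) (hs : HasBlochVector σ s)
    (ht : r 0 ^ 2 + r 1 ^ 2 = 0)
    (hc : Convertible IsMaximallyIncoherentOperation ρ σ) : s 0 = 0 ∧ s 1 = 0 := by
  obtain ⟨Λ, hΛ, hΛρ⟩ := hc
  have h0 : r 0 = 0 := by nlinarith
  have h1 : r 1 = 0 := by nlinarith
  have hd : ρ.IsDiag := by
    rw [hasBlochVector_iff.1 hr, h0, h1]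
    intro i j hij
    fin_cases i <;> fin_cases j <;> simp at hij ⊢
  have h01 : σ 0 1 = 0 := by
    rw [← hΛρ]
    exact (hΛ.2 ρ ⟨hρ, hd⟩).2 (by decide)
  rw [hasBlochVector_iff.1 hs] at h01
  have hre := congrArg Complex.re h01
  have him := congrArg Complex.im h01
  simp at hre him
  exact ⟨hre, him⟩

/-! ### Sufficiency by strictly incoherent operations -/

theorem isStrictlyIncoherentOperator_diag (a b : ℂ) :
    IsStrictlyIncoherentOperator !![a, 0; 0, b] := by
  constructor
  · intro m
    refine ⟨m, ![a, b] m, ?_⟩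
    ext i
    fin_cases m <;> fin_cases i <;> simp
  · intro m
    refine ⟨m, ![star a, star b] m, ?_⟩
    ext i
    fin_cases m <;> fin_cases i <;> simp

theorem isStrictlyIncoherentOperator_antidiag (a b : ℂ) :
    IsStrictlyIncoherentOperator !![0, a; b, 0] := by
  constructor
  · intro m
    refine ⟨1 - m, ![b, a] m, ?_⟩
    ext i
    fin_cases m <;> fin_cases i <;> simp
  · intro m
    refine ⟨1 - m, ![star a, star b] m, ?_⟩
    ext i
    fin_cases m <;> fin_cases i <;> simp

theorem sufficient_of_incoherent {ρ σ : Matrix (Fin 2) (Fin 2) ℂ} (hσ : IsDensityMatrix σ)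
    {r s : Fin 3 → ℝ} (hr : HasBlochVector ρ r) (hs : HasBlochVector σ s)
    (h : s 0 = 0 ∧ s 1 = 0) : Convertible IsStrictlyIncoherentOperation ρ σ := by
  have hle := hs.sq_le hσ
  obtain ⟨h0, h1⟩ := h
  have hz : s 2 ^ 2 ≤ 1 := by nlinarith
  obtain ⟨hz1, hz2⟩ := abs_le.1 ((sq_le_one_iff_abs_le_one _).1 hz)
  have hp : ((√((1 + s 2) / 2) : ℝ) : ℂ) * √((1 + s 2) / 2) = (1 + s 2) / 2 := by
    rw [← Complex.ofReal_mul, Real.mul_self_sqrt (by linarith)]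
    push_cast
    rfl
  have hq : ((√((1 - s 2) / 2) : ℝ) : ℂ) * √((1 - s 2) / 2) = (1 - s 2) / 2 := by
    rw [← Complex.ofReal_mul, Real.mul_self_sqrt (by linarith)]
    push_cast
    rfl
  generalize √((1 + s 2) / 2) = p at hp
  generalize √((1 - s 2) / 2) = q at hq
  -- The channel that discards its input and prepares the diagonal state `σ`.
  refine convertible_of_kraus ![!![(p : ℂ), 0; 0, 0], !![0, (p : ℂ); 0, 0],
    !![0, 0; (q : ℂ), 0], !![0, 0; 0, (q : ℂ)]] (fun j => ?_) ?_ ?_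
  · fin_cases j
    · exact isStrictlyIncoherentOperator_diag _ _
    · exact isStrictlyIncoherentOperator_antidiag _ _
    · exact isStrictlyIncoherentOperator_antidiag _ _
    · exact isStrictlyIncoherentOperator_diag _ _
  · ext i j
    fin_cases i <;> fin_cases j <;>
      simp [Fin.sum_univ_four, Matrix.mul_apply, Fin.sum_univ_two]
    · linear_combination hp + hq
    · linear_combination hp + hq
  · rw [hasBlochVector_iff.1 hr, hasBlochVector_iff.1 hs, h0, h1]
    ext i j
    simp only [Fin.sum_univ_four, Matrix.add_apply, Matrix.mul_apply, Fin.sum_univ_two]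
    fin_cases i <;> fin_cases j <;> simp
    · linear_combination hp
    · linear_combination hq

/-- Two angles with prescribed difference and prescribed weighted difference of the cosines of
the doubled angles. -/
theorem exists_angles {m z w : ℝ} (hm0 : 0 ≤ m) (hm1 : m ≤ 1)
    (h : w ^ 2 ≤ 1 - (1 - z ^ 2) * m ^ 2) :
    ∃ α β : ℝ, Real.cos α * Real.cos β + Real.sin α * Real.sin β = m ∧
      (1 + z) / 2 * Real.cos (2 * α) - (1 - z) / 2 * Real.cos (2 * β) = w := by
  set δ := Real.arccos m
  have hδ : Real.cos δ = m := Real.cos_arccos (by linarith) hm1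
  -- With `α = θ / 2 + δ` and `β = θ / 2` the difference of the angles is fixed, and the weighted
  -- difference is a sinusoid in `θ` with amplitude `‖Z‖` and phase `Z.arg`, so it attains every `w`
  -- with `|w| ≤ ‖Z‖`.
  set Z : ℂ := ⟨(1 + z) / 2 * Real.cos (2 * δ) - (1 - z) / 2, -((1 + z) / 2 * Real.sin (2 * δ))⟩
  have hZ : ‖Z‖ ^ 2 = 1 - (1 - z ^ 2) * m ^ 2 := by
    rw [← Complex.normSq_eq_norm_sq, Complex.normSq_apply]
    have h1 := Real.sin_sq_add_cos_sq (2 * δ)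
    have h2 := Real.cos_two_mul δ
    rw [hδ] at h2
    simp only [Z]
    linear_combination ((1 + z) / 2) ^ 2 * h1 - (1 - z ^ 2) / 2 * h2
  have hw : |w| ≤ ‖Z‖ := abs_le_of_sq_le_sq (by rw [hZ]; exact h) (norm_nonneg _)
  obtain ⟨hw1, hw2⟩ := abs_le.1 hw
  have hcos : ‖Z‖ * Real.cos (Real.arccos (w / ‖Z‖)) = w := by
    -- If `Z = 0` then `w = 0`, and the junk value of `w / 0` is harmless.
    rcases (norm_nonneg Z).eq_or_lt with h0 | hpos
    · rw [← h0] at hw ⊢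
      simpa using (abs_nonpos_iff.1 hw).symm
    · rw [Real.cos_arccos (by rw [le_div_iff₀ hpos]; linarith)
        (by rw [div_le_iff₀ hpos]; linarith)]
      field_simp
  have hre : ‖Z‖ * Real.cos Z.arg = Z.re := Complex.norm_mul_cos_arg Z
  have him : ‖Z‖ * Real.sin Z.arg = Z.im := Complex.norm_mul_sin_arg Z
  set θ := Z.arg + Real.arccos (w / ‖Z‖) with hθ
  refine ⟨θ / 2 + δ, θ / 2, ?_, ?_⟩
  · rw [← Real.cos_sub, add_sub_cancel_left, hδ]
  · have hα : 2 * (θ / 2 + δ) = θ + 2 * δ := by ring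
    have hβ : 2 * (θ / 2) = θ := by ring
    have hsub : Real.cos (Real.arccos (w / ‖Z‖)) =
        Real.cos θ * Real.cos Z.arg + Real.sin θ * Real.sin Z.arg := by
      rw [← Real.cos_sub, hθ, add_sub_cancel_left]
    rw [hα, hβ, Real.cos_add, ← hcos, hsub]
    simp only [Z] at hre him
    linear_combination -Real.cos θ * hre - Real.sin θ * him

theorem sufficient_of_coherent {ρ σ : Matrix (Fin 2) (Fin 2) ℂ}
    {r s : Fin 3 → ℝ} (hr : HasBlochVector ρ r) (hs : HasBlochVector σ s)
    (ht : r 0 ^ 2 + r 1 ^ 2 ≠ 0)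
    (h : s 0 ^ 2 + s 1 ^ 2 ≤ r 0 ^ 2 + r 1 ^ 2 ∧
      s 2 ^ 2 ≤ 1 - (1 - r 2 ^ 2) / (r 0 ^ 2 + r 1 ^ 2) * (s 0 ^ 2 + s 1 ^ 2)) :
    Convertible IsStrictlyIncoherentOperation ρ σ := by
  obtain ⟨h1, h2⟩ := h
  have htpos : 0 < r 0 ^ 2 + r 1 ^ 2 := lt_of_le_of_ne (by positivity) (Ne.symm ht)
  set τ : ℂ := r 0 - r 1 * Complex.I with hτ
  set υ : ℂ := s 0 - s 1 * Complex.I with hυ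
  have hτc : star τ = r 0 + r 1 * Complex.I := by simp [hτ]
  have hυc : star υ = s 0 + s 1 * Complex.I := by simp [hυ]
  have hτn : ‖τ‖ ^ 2 = r 0 ^ 2 + r 1 ^ 2 := by
    rw [← Complex.normSq_eq_norm_sq, Complex.normSq_apply]
    simp [hτ]
    ring
  have hυn : ‖υ‖ ^ 2 = s 0 ^ 2 + s 1 ^ 2 := by
    rw [← Complex.normSq_eq_norm_sq, Complex.normSq_apply]
    simp [hυ]
    ring
  have hτ0 : τ ≠ 0 := fun h0 => by simp [h0] at hτn; exact ht hτn.symm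
  have hτs0 : star τ ≠ 0 := star_ne_zero.2 hτ0
  set m := ‖υ / τ‖ with hm
  have hm2 : m ^ 2 = (s 0 ^ 2 + s 1 ^ 2) / (r 0 ^ 2 + r 1 ^ 2) := by
    rw [hm, norm_div, div_pow, hτn, hυn]
  have hm1 : m ≤ 1 := by
    rw [← sq_le_one_iff₀ (norm_nonneg _), hm2]
    exact div_le_one_of_le₀ h1 htpos.le
  obtain ⟨α, β, hαβ, hw⟩ := exists_angles (m := m) (z := r 2) (w := s 2) (norm_nonneg _) hm1
    (by rw [hm2]; convert h2 using 2; ring)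
  obtain ⟨ω, hω, hωm⟩ : ∃ ω : ℂ, ω * star ω = 1 ∧ υ = m * ω * τ := by
    refine ⟨Complex.exp ((υ / τ).arg * Complex.I), ?_, ?_⟩
    · rw [Complex.star_def, Complex.mul_conj, Complex.normSq_eq_norm_sq,
        Complex.norm_exp_ofReal_mul_I]
      simp
    · rw [hm, Complex.norm_mul_exp_arg_mul_I]
      field_simp
  have hωm' : star υ = m * star ω * star τ := by
    rw [hωm, star_mul', star_mul']
    simp
  -- The antidiagonal Kraus operator swaps `τ` with `star τ`; the phase `χ` realigns its
  -- contribution with `ω * τ`, so that the two contributions add up to the factor `cos (α - β) =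
  -- m`.
  set χ : ℂ := ω * τ / star τ with hχ
  have hχτ : χ * star τ = ω * τ := by rw [hχ]; field_simp
  have hχτ' : star χ * τ = star ω * star τ := by
    simpa [mul_comm] using congrArg star hχτ
  have hχ1 : χ * star χ = 1 := by
    have : χ * star χ * (τ * star τ) = 1 * (τ * star τ) := by
      linear_combination hχτ * (star χ * τ) + ω * τ * hχτ' + τ * star τ * hω
    exact mul_right_cancel₀ (mul_ne_zero hτ0 hτs0) this
  have hca := Complex.cos_sq_add_sin_sq α
  have hcb := Complex.cos_sq_add_sin_sq β
  have hαβC : Complex.cos α * Complex.cos β + Complex.sin α * Complex.sin β = (m : ℂ) := by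
    rw [← hαβ]; push_cast; rfl
  have hwC : (1 + r 2) / 2 * (2 * Complex.cos α ^ 2 - 1) -
      (1 - r 2) / 2 * (2 * Complex.cos β ^ 2 - 1) = (s 2 : ℂ) := by
    rw [← hw, Real.cos_two_mul, Real.cos_two_mul]; push_cast; rfl
  rw [hasBlochVector_iff, ← hτ, ← hτc] at hr
  rw [hasBlochVector_iff, ← hυ, ← hυc] at hs
  rw [hr, hs, hωm', hωm, ← hαβC]
  have hsc : ∀ x : ℝ, star (Complex.cos x) = Complex.cos x := fun x => by
    rw [← Complex.ofReal_cos]; exact Complex.conj_ofReal _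
  have hss : ∀ x : ℝ, star (Complex.sin x) = Complex.sin x := fun x => by
    rw [← Complex.ofReal_sin]; exact Complex.conj_ofReal _
  have hscα := hsc α
  have hscβ := hsc β
  have hssα := hss α
  have hssβ := hss β
  clear_value χ τ υ m
  generalize Complex.cos α = a at *
  generalize Complex.cos β = b at *
  generalize Complex.sin α = c at *
  generalize Complex.sin β = d at *
  generalize star τ = τ' at *
  generalize hω' : star ω = ω' at *
  generalize hχ' : star χ = χ' at *
  refine convertible_of_kraus ![!![ω * a, 0; 0, b], !![0, χ * d; c, 0]] (fun j => ?_) ?_ ?_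
  · fin_cases j
    · exact isStrictlyIncoherentOperator_diag _ _
    · exact isStrictlyIncoherentOperator_antidiag _ _
  · ext i j
    fin_cases i <;> fin_cases j <;>
      simp only [Fin.sum_univ_two, Matrix.mul_apply, Matrix.add_apply, Matrix.conjTranspose_apply,
        Matrix.of_apply, Matrix.cons_val', Matrix.cons_val_zero, Matrix.cons_val_one,
        Matrix.cons_val_fin_one, Fin.zero_eta, Fin.mk_one, Fin.isValue, star_mul', star_zero,
        hω', hχ', hscα, hscβ, hssα, hssβ, Matrix.one_apply_eq, Matrix.one_apply, zero_ne_one,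
        one_ne_zero, if_false]
    · linear_combination hca + a ^ 2 * hω
    · ring
    · ring
    · linear_combination hcb + d ^ 2 * hχ1
  · ext i j
    fin_cases i <;> fin_cases j <;>
      simp only [Fin.sum_univ_two, Matrix.mul_apply, Matrix.add_apply, Matrix.conjTranspose_apply,
        Matrix.of_apply, Matrix.cons_val', Matrix.cons_val_zero, Matrix.cons_val_one,
        Matrix.cons_val_fin_one, Fin.zero_eta, Fin.mk_one, Fin.isValue, star_mul', star_zero,
        hω', hχ', hscα, hscβ, hssα, hssβ]
    · linear_combination (1 + r 2) / 2 * a ^ 2 * hω + (1 - r 2) / 2 * d ^ 2 * hχ1 +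
        (1 - r 2) / 2 * hcb + hwC / 2
    · linear_combination c * d / 2 * hχτ
    · linear_combination c * d / 2 * hχτ'
    · linear_combination (1 + r 2) / 2 * hca - hwC / 2

end Qubit

end Coherence

theorem mainTheorem4 (ρ σ : Matrix (Fin 2) (Fin 2) ℂ)
    (hρ : Coherence.IsDensityMatrix ρ) (hσ : Coherence.IsDensityMatrix σ)
    (r s : Fin 3 → ℝ)
    (hr : Coherence.HasBlochVector ρ r) (hs : Coherence.HasBlochVector σ s) :
    (r 0 ^ 2 + r 1 ^ 2 ≠ 0 →
      (Coherence.Convertible Coherence.IsStrictlyIncoherentOperation ρ σ ↔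
        s 0 ^ 2 + s 1 ^ 2 ≤ r 0 ^ 2 + r 1 ^ 2 ∧
        s 2 ^ 2 ≤ 1 - (1 - r 2 ^ 2) / (r 0 ^ 2 + r 1 ^ 2) * (s 0 ^ 2 + s 1 ^ 2)) ∧
      (Coherence.Convertible Coherence.IsIncoherentOperation ρ σ ↔
        s 0 ^ 2 + s 1 ^ 2 ≤ r 0 ^ 2 + r 1 ^ 2 ∧
        s 2 ^ 2 ≤ 1 - (1 - r 2 ^ 2) / (r 0 ^ 2 + r 1 ^ 2) * (s 0 ^ 2 + s 1 ^ 2)) ∧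
      (Coherence.Convertible Coherence.IsMaximallyIncoherentOperation ρ σ ↔
        s 0 ^ 2 + s 1 ^ 2 ≤ r 0 ^ 2 + r 1 ^ 2 ∧
        s 2 ^ 2 ≤ 1 - (1 - r 2 ^ 2) / (r 0 ^ 2 + r 1 ^ 2) * (s 0 ^ 2 + s 1 ^ 2))) ∧
    (r 0 ^ 2 + r 1 ^ 2 = 0 →
      (Coherence.Convertible Coherence.IsStrictlyIncoherentOperation ρ σ ↔ s 0 = 0 ∧ s 1 = 0) ∧
      (Coherence.Convertible Coherence.IsIncoherentOperation ρ σ ↔ s 0 = 0 ∧ s 1 = 0) ∧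
      (Coherence.Convertible Coherence.IsMaximallyIncoherentOperation ρ σ ↔
        s 0 = 0 ∧ s 1 = 0)) := by
  refine ⟨fun ht => ?_, fun ht => ?_⟩
  · exact Coherence.convertible_iff_of_necessary_of_sufficient
      (Coherence.necessary_of_coherent hρ hr hs ht) (Coherence.sufficient_of_coherent hr hs ht)
  · exact Coherence.convertible_iff_of_necessary_of_sufficient
      (Coherence.necessary_of_incoherent hρ hr hs ht) (Coherence.sufficient_of_incoherent hσ hr hs)
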